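/- Let $n\ge 1$ and let $A=[a_{ij}]\in\mathbb R^{n\times n}$ be a real matrix (entries of either sign) with $a_{ii}=0$ for all $i$. Let $\mathcal G(A)$ be the signed digraph on $\{1,\dots,n\}$ with an edge from $j$ to $i$ if and only if $a_{ij}\neq 0$. Put $d_i=\sum_j|a_{ij}|$, $\Delta=\max_i d_i$ and $L=\mathrm{diag}(d_1,\dots,d_n)-A$. Let $0<\kappa<1/\Delta$ (with $1/\Delta=\infty$ if $\Delta=0$), and consider the discrete-time system $$x(k+1)=x(k)-\kappa Lx(k),\qquad x(k)\in\mathbb R^n,\quad k=0,1,2,\dots$$ The system is said to achieve bipartite consensus if for every initial state $x(0)\in\mathbb R^n$ all limits $c_i=\lim_{k\to\infty}x_i(k)$ exist and $|c_1|=\dots=|c_n|$, and if for some initial state this common absolute value is positive. The matrix $A$ is called essentially nonnegative if there is $\zeta\in\mathbb C^n$ with $|\zeta_i|=1$ for all $i$ such that $D_\zeta^{-1}AD_\zeta$ has nonnegative real entries, where $D_\zeta=\mathrm{diag}(\zeta_1,\dots,\zeta_n)$. The digraph $\mathcal G(A)$ has a spanning tree if some vertex has a directed path to every other vertex. Then the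 system achieves bipartite consensus if and only if $A$ is essentially nonnegative and $\mathcal G(A)$ has a spanning tree. In this case there is $\sigma\in\{\pm1\}^n$ such that $D_\sigma AD_\sigma$ is a nonnegative matrix. Moreover, for each such $\sigma$ there is $\eta\in\mathbb R^n$ of the form $\eta=D_\sigma\nu$, with $\nu$ entrywise nonnegative, such that $\eta^TL=0$ and $\|\eta\|_1=\sum_i|\eta_i|=1$; and for each such $\sigma$ and $\eta$ and every initial state $x(0)\in\mathbb R^n$, $$\lim_{k\to\infty}x(k)=(\eta^Tx(0))\,\sigma .$$ -/

import Mathlib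

open Filter Topology

namespace SignedConsensus

/-- The digraph of a square matrix `A`: there is an edge from `j` to `i` iff `A i j ≠ 0`. -/
def assocDigraph {n : ℕ} (A : Matrix (Fin n) (Fin n) ℝ) : Digraph (Fin n) where
  Adj j i := A i j ≠ 0

/-- Some vertex (a root) is joined by a directed path to every other vertex. -/
def HasSpanningTree {n : ℕ} (G : Digraph (Fin n)) : Prop :=
  ∃ r, ∀ i, Relation.ReflTransGen G.Adj r i

/-- The modulus degree `d i = ∑ j, |a i j|`; the indices with `a i j = 0` contribute nothing. -/
def modDegree {n : ℕ} (A : Matrix (Fin n) (Fin n) ℝ) (i : Fin n) : ℝ :=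
  ∑ j, |A i j|

/-- The maximum modulus degree `Δ`. -/
noncomputable def maxDegree {n : ℕ} [NeZero n] (A : Matrix (Fin n) (Fin n) ℝ) : ℝ :=
  Finset.univ.sup' Finset.univ_nonempty (modDegree A)

/-- The Laplacian `L = D - A`, where `D` is the modulus degree matrix. -/
def laplacian {n : ℕ} (A : Matrix (Fin n) (Fin n) ℝ) : Matrix (Fin n) (Fin n) ℝ :=
  Matrix.diagonal (modDegree A) - A

/-- Switching equivalence of complex matrices: `A₂ = D_ζ⁻¹ A₁ D_ζ` with all `ζ i` on the
unit circle. -/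
def SwitchingEquivalent {n : ℕ} (A₁ A₂ : Matrix (Fin n) (Fin n) ℂ) : Prop :=
  ∃ ζ : Fin n → ℂ, (∀ i, ‖ζ i‖ = 1) ∧
    A₂ = (Matrix.diagonal ζ)⁻¹ * A₁ * Matrix.diagonal ζ

/-- A complex matrix is essentially nonnegative if it is switching equivalent to a matrix with
nonnegative real entries. -/
def EssentiallyNonneg {n : ℕ} (A : Matrix (Fin n) (Fin n) ℂ) : Prop :=
  ∃ B : Matrix (Fin n) (Fin n) ℝ, (∀ i j, 0 ≤ B i j) ∧
    SwitchingEquivalent A (B.map Complex.ofReal)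

/-- `x` is a trajectory of `x(k+1) = x(k) - κ L x(k)`. -/
def IsTrajectory {n : ℕ} (A : Matrix (Fin n) (Fin n) ℝ) (κ : ℝ) (x : ℕ → Fin n → ℝ) : Prop :=
  ∀ k, x (k + 1) = x k - κ • (laplacian A).mulVec (x k)

/-- Bipartite consensus: from every initial state the states of all agents converge, to limits
which agree up to sign, and this is not for the trivial reason that all trajectories die out:
the common absolute value of the limits is positive for some initial state (by linearity, then
for all initial states outside a proper linear subspace). -/
def AchievesBipartiteConsensus {n : ℕ} (A : Matrix (Fin n) (Fin n) ℝ) (κ : ℝ) : Prop :=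
  (∀ x, IsTrajectory A κ x →
    ∃ c : Fin n → ℝ, (∀ i, Tendsto (fun k => x k i) atTop (𝓝 (c i))) ∧
      ∀ i j, |c i| = |c j|) ∧
  ∃ x, IsTrajectory A κ x ∧
    ∃ a : ℝ, 0 < a ∧ ∀ i, Tendsto (fun k => |x k i|) atTop (𝓝 a)

/-- `σ ∈ {±1}ⁿ` and `D_σ A D_σ` is a nonnegative matrix. -/
def IsSignSwitching {n : ℕ} (A : Matrix (Fin n) (Fin n) ℝ) (σ : Fin n → ℝ) : Prop :=
  (∀ i, σ i = 1 ∨ σ i = -1) ∧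
    ∀ i j, 0 ≤ (Matrix.diagonal σ * A * Matrix.diagonal σ) i j

/-- `η = D_σ ν` with `ν` entrywise nonnegative, `ηᵀ L = 0` and `‖η‖₁ = 1`. The condition on `ν`
fixes the sign of `η` relative to that of `σ`. -/
def IsNormalizedLeftNull {n : ℕ} (A : Matrix (Fin n) (Fin n) ℝ) (σ η : Fin n → ℝ) : Prop :=
  (∃ ν : Fin n → ℝ, (∀ i, 0 ≤ ν i) ∧ η = (Matrix.diagonal σ).mulVec ν) ∧
    Matrix.vecMul η (laplacian A) = 0 ∧ ∑ i, |η i| = 1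

end SignedConsensus

/-! If signs `σ` switch `A` to `|A|`, the vector `D_σ x` evolves by `P = I - κD + κ|A|`, where `D`
is the diagonal matrix of the degrees. As `κ d_i < 1`, `P` is row stochastic with positive diagonal.
A root makes a column of some power of `P` positive, which contracts the spread max - min; hence `x`
tends to a multiple of `σ` (`tendsto_const_of_stochastic`). The coefficients obtained from the basis
vectors form `η`, and conservation of `ηᵀx` identifies the limit for any admissible `η`.

Conversely, a limit with entries of common modulus `a > 0` is an equilibrium. Divided by `a` it is a
sign vector `σ` with `Lσ = 0`, which forces equality in every bound `σ_i a_ij σ_j ≤ |a_ij|`. By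
linearity some basis vector `e_r` has a nonzero limit, and supports spread only along edges, so `r`
is a root.

Complex phases reduce to signs because `A` is real: across an edge the phase changes only by a sign,
and every vertex is reached from the root. -/

/-! ### Convergence for stochastic matrices -/

/-- If a nonnegative square matrix has positive diagonal and the vertex `r` reaches every vertex of
its digraph, then some power of it has a positive `r`-th column. -/
theorem exists_pow_column_pos {ι : Type*} [Fintype ι] [DecidableEq ι]
    {P : Matrix ι ι ℝ} (hP : ∀ i j, 0 ≤ P i j) (hd : ∀ i, 0 < P i i) {r : ι}
    (hr : ∀ i, Relation.ReflTransGen (fun j i => 0 < P i j) r i) :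
    ∃ N : ℕ, ∀ i, 0 < (P ^ N) i r := by
  have hnn : ∀ (k : ℕ) i j, 0 ≤ (P ^ k) i j := by
    intro k
    induction k with
    | zero => intro i j; rw [pow_zero, Matrix.one_apply]; split_ifs <;> norm_num
    | succ k ih =>
      intro i j
      rw [pow_succ', Matrix.mul_apply]
      exact Finset.sum_nonneg fun l _ => mul_nonneg (hP i l) (ih l j)
  have hstep : ∀ (k : ℕ) i j, 0 < P i j → 0 < (P ^ k) j r → 0 < (P ^ (k + 1)) i r := by
    intro k i j hij hj
    rw [pow_succ', Matrix.mul_apply]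
    exact Finset.sum_pos' (fun l _ => mul_nonneg (hP i l) (hnn k l r))
      ⟨j, Finset.mem_univ j, mul_pos hij hj⟩
  have hmono : ∀ i (k l : ℕ), k ≤ l → 0 < (P ^ k) i r → 0 < (P ^ l) i r := by
    intro i k l hkl hk
    induction l, hkl using Nat.le_induction with
    | base => exact hk
    | succ l _ ih => exact hstep l i i (hd i) ih
  have hex : ∀ i, ∃ k : ℕ, 0 < (P ^ k) i r := by
    intro i
    induction hr i with
    | refl => exact ⟨0, by simp⟩
    | tail _ hbc ih =>
      obtain ⟨k, hk⟩ := ih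
      exact ⟨k + 1, hstep k _ _ hbc hk⟩
  choose k hk using hex
  exact ⟨Finset.univ.sup k, fun i => hmono i _ _ (Finset.le_sup (Finset.mem_univ i)) (hk i)⟩

/-- An average with weight at least `ε` on `r` of numbers bounded by `M`. -/
theorem weighted_sum_le {ι : Type*} [Fintype ι] {w v : ι → ℝ} {M ε : ℝ} {r : ι}
    (hw : ∀ i, 0 ≤ w i) (hs : ∑ i, w i = 1) (hε : ε ≤ w r) (hv : ∀ i, v i ≤ M) :
    ∑ i, w i * v i ≤ (1 - ε) * M + ε * v r := by
  have h1 : w r * (M - v r) ≤ ∑ i, w i * (M - v i) :=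
    Finset.single_le_sum (f := fun i => w i * (M - v i))
      (fun i _ => mul_nonneg (hw i) (sub_nonneg.2 (hv i))) (Finset.mem_univ r)
  have h2 : ∑ i, w i * (M - v i) = M - ∑ i, w i * v i := by
    simp only [mul_sub, Finset.sum_sub_distrib, ← Finset.sum_mul, hs, one_mul]
  have h3 : ε * (M - v r) ≤ w r * (M - v r) :=
    mul_le_mul_of_nonneg_right hε (sub_nonneg.2 (hv r))
  linarith

/-- An average with weight at least `ε` on `r` of numbers bounded below by `m`. -/
theorem le_weighted_sum {ι : Type*} [Fintype ι] {w v : ι → ℝ} {m ε : ℝ} {r : ι}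
    (hw : ∀ i, 0 ≤ w i) (hs : ∑ i, w i = 1) (hε : ε ≤ w r) (hv : ∀ i, m ≤ v i) :
    (1 - ε) * m + ε * v r ≤ ∑ i, w i * v i := by
  have := weighted_sum_le (v := fun i => - v i) (M := -m) hw hs hε (fun i => neg_le_neg (hv i))
  simp only [mul_neg, Finset.sum_neg_distrib] at this
  linarith

open Matrix in
/-- The powers of a row stochastic matrix with positive diagonal whose digraph has a root drive
every vector to a constant vector. -/
theorem tendsto_const_of_stochastic {ι : Type*} [Fintype ι] [DecidableEq ι]
    {P : Matrix ι ι ℝ} (hP : ∀ i j, 0 ≤ P i j) (hs : ∀ i, ∑ j, P i j = 1)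
    (hd : ∀ i, 0 < P i i) {r : ι}
    (hr : ∀ i, Relation.ReflTransGen (fun j i => 0 < P i j) r i)
    {y : ℕ → ι → ℝ} (hy : ∀ k, y (k + 1) = P *ᵥ y k) :
    ∃ c : ℝ, ∀ i, Tendsto (fun k => y k i) atTop (𝓝 c) := by
  have : Nonempty ι := ⟨r⟩
  obtain ⟨N, hN⟩ := exists_pow_column_pos hP hd hr
  have hpow : ∀ k : ℕ, (∀ i j, 0 ≤ (P ^ k) i j) ∧ ∀ i, ∑ j, (P ^ k) i j = 1 := by
    intro k
    have h : P ^ k ∈ rowStochastic ℝ ι :=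
      pow_mem (mem_rowStochastic_iff_sum.2 ⟨hP, hs⟩) k
    exact mem_rowStochastic_iff_sum.1 h
  obtain ⟨i₀, hi₀⟩ := Finite.exists_min fun i => (P ^ N) i r
  set ε := (P ^ N) i₀ r with hεdef
  have hε : 0 < ε := hN i₀
  have hyk : ∀ k m : ℕ, y (k + m) = (P ^ m) *ᵥ y k := by
    intro k m
    induction m with
    | zero => simp
    | succ m ih => rw [← add_assoc, hy, ih, Matrix.mulVec_mulVec, ← pow_succ']
  let M : ℕ → ℝ := fun k => Finset.univ.sup' Finset.univ_nonempty (y k)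
  let m : ℕ → ℝ := fun k => Finset.univ.inf' Finset.univ_nonempty (y k)
  have hyM : ∀ k i, y k i ≤ M k := fun k i => Finset.le_sup' (y k) (Finset.mem_univ i)
  have hmy : ∀ k i, m k ≤ y k i := fun k i => Finset.inf'_le (y k) (Finset.mem_univ i)
  have hM : Antitone M := antitone_nat_of_succ_le fun k => by
    refine Finset.sup'_le _ _ fun i _ => ?_
    -- Used with `ε = 0`: an average does not exceed the maximum.
    have := weighted_sum_le (hP i) (hs i) (hP i r) (hyM k)
    rw [hy]
    simpa [Matrix.mulVec, dotProduct] using this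
  have hm : Monotone m := monotone_nat_of_le_succ fun k => by
    refine Finset.le_inf' _ _ fun i _ => ?_
    have := le_weighted_sum (hP i) (hs i) (hP i r) (hmy k)
    rw [hy]
    simpa [Matrix.mulVec, dotProduct] using this
  have hmM : ∀ k, m k ≤ M k := fun k => (hmy k r).trans (hyM k r)
  have hMlim := tendsto_atTop_ciInf hM
    ⟨m 0, by rintro _ ⟨k, rfl⟩; exact (hm (Nat.zero_le k)).trans (hmM k)⟩
  have hmlim := tendsto_atTop_ciSup hm
    ⟨M 0, by rintro _ ⟨k, rfl⟩; exact (hmM k).trans (hM (Nat.zero_le k))⟩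
  set a := ⨅ k, M k
  set b := ⨆ k, m k
  -- Both bounds contain the same term `ε * y k r`, which cancels in the difference.
  have hcontr : ∀ k, M (k + N) - m (k + N) ≤ (1 - ε) * (M k - m k) := by
    intro k
    have h1 : M (k + N) ≤ (1 - ε) * M k + ε * y k r := by
      refine Finset.sup'_le _ _ fun i _ => ?_
      rw [hyk]
      exact weighted_sum_le ((hpow N).1 i) ((hpow N).2 i) (hi₀ i) (hyM k)
    have h2 : (1 - ε) * m k + ε * y k r ≤ m (k + N) := by
      refine Finset.le_inf' _ _ fun i _ => ?_
      rw [hyk]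
      exact le_weighted_sum ((hpow N).1 i) ((hpow N).2 i) (hi₀ i) (hmy k)
    linarith
  have hdiff : Tendsto (fun k => M k - m k) atTop (𝓝 (a - b)) := hMlim.sub hmlim
  -- The contraction is passed to the limit, so no geometric rate is needed.
  have hle : a - b ≤ (1 - ε) * (a - b) :=
    le_of_tendsto_of_tendsto' ((tendsto_add_atTop_iff_nat N).2 hdiff) (hdiff.const_mul _) hcontr
  have hge : b ≤ a := le_of_tendsto_of_tendsto' hmlim hMlim hmM
  have hab : b = a := by nlinarith
  rw [hab] at hmlim
  exact ⟨a, fun i => tendsto_of_tendsto_of_tendsto_of_le_of_le hmlim hMlim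
    (fun k => hmy k i) (fun k => hyM k i)⟩

/-! ### Trajectories -/

namespace SignedConsensus

open Matrix

variable {n : ℕ} {A : Matrix (Fin n) (Fin n) ℝ} {κ : ℝ} {σ : Fin n → ℝ}

theorem mul_modDegree_lt_one [NeZero n] (hκ : 0 < κ) (hκΔ : κ * maxDegree A < 1) (i : Fin n) :
    κ * modDegree A i < 1 :=
  (mul_le_mul_of_nonneg_left (Finset.le_sup' (modDegree A) (Finset.mem_univ i)) hκ.le).trans_lt
    hκΔ

theorem IsTrajectory.succ_apply {x : ℕ → Fin n → ℝ} (hx : IsTrajectory A κ x) (k : ℕ)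
    (i : Fin n) :
    x (k + 1) i = (1 - κ * modDegree A i) * x k i + κ * ∑ j, A i j * x k j := by
  rw [hx k]
  simp only [laplacian, sub_mulVec, Pi.sub_apply, Pi.smul_apply, smul_eq_mul, mulVec_diagonal]
  simp only [mulVec, dotProduct]
  ring

/-- The trajectory with a prescribed initial state. -/
noncomputable def trajectory (A : Matrix (Fin n) (Fin n) ℝ) (κ : ℝ) (v : Fin n → ℝ) (k : ℕ) :
    Fin n → ℝ :=
  ((1 - κ • laplacian A) ^ k) *ᵥ v

theorem trajectory_zero (v : Fin n → ℝ) : trajectory A κ v 0 = v := by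
  simp [trajectory]

theorem isTrajectory_trajectory (v : Fin n → ℝ) : IsTrajectory A κ (trajectory A κ v) := by
  intro k
  simp only [trajectory]
  rw [pow_succ', ← mulVec_mulVec, sub_mulVec, one_mulVec, smul_mulVec]

theorem IsTrajectory.eq_trajectory {x : ℕ → Fin n → ℝ} (hx : IsTrajectory A κ x) (k : ℕ) :
    x k = trajectory A κ (x 0) k := by
  induction k with
  | zero => rw [trajectory_zero]
  | succ k ih => rw [hx k, isTrajectory_trajectory (x 0) k, ← ih]

theorem trajectory_eq_sum_single (v : Fin n → ℝ) (k : ℕ) (i : Fin n) :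
    trajectory A κ v k i = ∑ r, v r * trajectory A κ (Pi.single r 1) k i := by
  simp only [trajectory, mulVec_single_one, col_apply]
  exact dotProduct_comm _ _

/-- The support of a trajectory spreads along the edges of the digraph. -/
theorem reflTransGen_of_trajectory_single_ne_zero {r : Fin n} (k : ℕ) (i : Fin n)
    (h : trajectory A κ (Pi.single r 1) k i ≠ 0) :
    Relation.ReflTransGen (assocDigraph A).Adj r i := by
  induction k generalizing i with
  | zero =>
    rw [trajectory_zero] at h
    obtain rfl : i = r := by
      by_contra hir
      exact h (Pi.single_eq_of_ne hir _)
    exact .refl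
  | succ k ih =>
    rw [(isTrajectory_trajectory _).succ_apply] at h
    by_cases hi : trajectory A κ (Pi.single r 1) k i = 0
    · rw [hi, mul_zero, zero_add] at h
      obtain ⟨j, -, hj⟩ := Finset.exists_ne_zero_of_sum_ne_zero (right_ne_zero_of_mul h)
      exact (ih j (right_ne_zero_of_mul hj)).tail (left_ne_zero_of_mul hj)
    · exact ih i hi

/-! ### Sign switchings and convergence -/

theorem diagonal_mul_mul_diagonal_apply {R : Type*} [CommSemiring R] (s t : Fin n → R)
    (B : Matrix (Fin n) (Fin n) R) (i j : Fin n) :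
    (diagonal s * B * diagonal t) i j = s i * B i j * t j := by
  rw [mul_diagonal, diagonal_mul]

theorem isSignSwitching_iff : IsSignSwitching A σ ↔
    (∀ i, σ i = 1 ∨ σ i = -1) ∧ ∀ i j, 0 ≤ σ i * A i j * σ j := by
  simp only [IsSignSwitching, diagonal_mul_mul_diagonal_apply]

theorem mul_self_of_sign {s : ℝ} (h : s = 1 ∨ s = -1) : s * s = 1 := by
  rcases h with rfl | rfl <;> norm_num

theorem abs_of_sign {s : ℝ} (h : s = 1 ∨ s = -1) : |s| = 1 := by
  rcases h with rfl | rfl <;> norm_num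

theorem IsSignSwitching.mul_mul_eq_abs (h : IsSignSwitching A σ) (i j : Fin n) :
    σ i * A i j * σ j = |A i j| := by
  obtain ⟨h1, h2⟩ := isSignSwitching_iff.1 h
  rw [← abs_of_nonneg (h2 i j), abs_mul, abs_mul, abs_of_sign (h1 i), abs_of_sign (h1 j)]
  ring

/-- In the coordinates switched by `σ` the states reach a common limit. -/
theorem IsSignSwitching.exists_tendsto (h : IsSignSwitching A σ) (hκ : 0 < κ)
    (hd : ∀ i, κ * modDegree A i < 1) (ht : HasSpanningTree (assocDigraph A))
    {x : ℕ → Fin n → ℝ} (hx : IsTrajectory A κ x) :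
    ∃ c : ℝ, ∀ i, Tendsto (fun k => σ i * x k i) atTop (𝓝 c) := by
  obtain ⟨r, hr⟩ := ht
  let P : Matrix (Fin n) (Fin n) ℝ :=
    diagonal (fun i => 1 - κ * modDegree A i) + κ • A.map abs
  have hdiag : ∀ i j, 0 ≤ diagonal (fun i => 1 - κ * modDegree A i) i j := by
    intro i j
    rw [diagonal_apply]
    split_ifs
    · linarith [hd i]
    · exact le_rfl
  have hoff : ∀ i j, 0 ≤ κ * |A i j| := fun i j => mul_nonneg hκ.le (abs_nonneg _)
  have hPa : ∀ i j, P i j = diagonal (fun i => 1 - κ * modDegree A i) i j + κ * |A i j| :=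
    fun i j => rfl
  refine tendsto_const_of_stochastic (P := P) (r := r) (y := fun k i => σ i * x k i)
    (fun i j => ?_) (fun i => ?_) (fun i => ?_) (fun i => ?_) (fun k => ?_)
  · rw [hPa]; exact add_nonneg (hdiag i j) (hoff i j)
  · simp only [hPa, Finset.sum_add_distrib, ← Finset.mul_sum, diagonal_apply]
    simp [modDegree]
  · rw [hPa, diagonal_apply_eq]; linarith [hd i, hoff i i]
  · refine Relation.ReflTransGen.mono (fun j i hji => ?_) r i (hr i)
    rw [hPa]
    exact add_pos_of_nonneg_of_pos (hdiag i j) (mul_pos hκ (abs_pos.2 hji))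
  · ext i
    simp only [P, add_mulVec, Pi.add_apply, mulVec_diagonal, smul_mulVec, Pi.smul_apply,
      smul_eq_mul, hx.succ_apply]
    simp only [mulVec, dotProduct, map_apply, ← h.mul_mul_eq_abs, mul_add, Finset.mul_sum]
    congr 1
    · ring
    · refine Finset.sum_congr rfl fun j _ => ?_
      linear_combination (-(κ * σ i * A i j * x k j)) * mul_self_of_sign (h.1 j)

theorem IsSignSwitching.exists_tendsto_mul (h : IsSignSwitching A σ) (hκ : 0 < κ)
    (hd : ∀ i, κ * modDegree A i < 1) (ht : HasSpanningTree (assocDigraph A))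
    {x : ℕ → Fin n → ℝ} (hx : IsTrajectory A κ x) :
    ∃ c : ℝ, Tendsto x atTop (𝓝 (c • σ)) := by
  obtain ⟨c, hc⟩ := h.exists_tendsto hκ hd ht hx
  refine ⟨c, tendsto_pi_nhds.2 fun i => ?_⟩
  have := (hc i).mul_const (σ i)
  refine this.congr fun k => ?_
  linear_combination x k i * mul_self_of_sign (h.1 i)

/-! ### The left null vector and the limit -/

/-- Along a trajectory a left null vector of the Laplacian is a conserved quantity. -/
theorem IsTrajectory.dotProduct_eq {x : ℕ → Fin n → ℝ} (hx : IsTrajectory A κ x)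
    {η : Fin n → ℝ} (hη : η ᵥ* laplacian A = 0) (k : ℕ) : η ⬝ᵥ x k = η ⬝ᵥ x 0 := by
  induction k with
  | zero => rfl
  | succ k ih =>
    rw [hx k, dotProduct_sub, dotProduct_smul, dotProduct_mulVec, hη, zero_dotProduct,
      smul_zero, sub_zero, ih]

/-- Each `η_i σ_i` equals `ν_i = |η_i|`; this is where the sign convention on `η` enters. -/
theorem IsNormalizedLeftNull.dotProduct_eq_one {η : Fin n → ℝ} (hσ : ∀ i, σ i = 1 ∨ σ i = -1)
    (h : IsNormalizedLeftNull A σ η) : η ⬝ᵥ σ = 1 := by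
  obtain ⟨⟨ν, hν, rfl⟩, -, h1⟩ := h
  rw [← h1]
  refine Finset.sum_congr rfl fun i _ => ?_
  rw [mulVec_diagonal, abs_mul, abs_of_sign (hσ i), abs_of_nonneg (hν i)]
  linear_combination ν i * mul_self_of_sign (hσ i)

theorem IsSignSwitching.laplacian_mulVec (h : IsSignSwitching A σ) : laplacian A *ᵥ σ = 0 := by
  ext i
  simp only [laplacian, sub_mulVec, Pi.sub_apply, mulVec_diagonal, Pi.zero_apply, modDegree,
    ← h.mul_mul_eq_abs]
  simp only [mulVec, dotProduct, Finset.sum_mul, ← Finset.sum_sub_distrib]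
  refine Finset.sum_eq_zero fun j _ => ?_
  linear_combination A i j * σ j * mul_self_of_sign (h.1 i)

theorem IsSignSwitching.trajectory_eq (h : IsSignSwitching A σ) (k : ℕ) :
    trajectory A κ σ k = σ := by
  refine ((show IsTrajectory A κ (fun _ => σ) from fun k => ?_).eq_trajectory k).symm
  rw [h.laplacian_mulVec, smul_zero, sub_zero]

/-- The limit is some `c • σ`; pairing it with `η` gives `c`, and the pairing is constant in time.
-/
theorem IsSignSwitching.tendsto_of_isNormalizedLeftNull (h : IsSignSwitching A σ) (hκ : 0 < κ)
    (hd : ∀ i, κ * modDegree A i < 1) (ht : HasSpanningTree (assocDigraph A)) {η : Fin n → ℝ}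
    (hη : IsNormalizedLeftNull A σ η) {x : ℕ → Fin n → ℝ} (hx : IsTrajectory A κ x) :
    Tendsto x atTop (𝓝 ((η ⬝ᵥ x 0) • σ)) := by
  obtain ⟨c, hc⟩ := h.exists_tendsto_mul hκ hd ht hx
  have hcont : Continuous fun v : Fin n → ℝ => η ⬝ᵥ v := by fun_prop
  have h1 : Tendsto (fun k => η ⬝ᵥ x k) atTop (𝓝 (η ⬝ᵥ (c • σ))) := (hcont.tendsto _).comp hc
  simp only [hx.dotProduct_eq hη.2.1, dotProduct_smul, hη.dotProduct_eq_one h.1, smul_eq_mul,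
    mul_one] at h1
  rwa [tendsto_nhds_unique tendsto_const_nhds h1]

/-- The coordinates of the left null vector are the limits of the trajectories issuing from the
basis vectors. -/
theorem IsSignSwitching.exists_isNormalizedLeftNull [NeZero n] (h : IsSignSwitching A σ)
    (hκ : 0 < κ) (hd : ∀ i, κ * modDegree A i < 1) (ht : HasSpanningTree (assocDigraph A)) :
    ∃ η, IsNormalizedLeftNull A σ η := by
  have hlim : ∀ r : Fin n, ∃ c : ℝ,
      Tendsto (trajectory A κ (Pi.single r 1)) atTop (𝓝 (c • σ)) := fun r =>
    h.exists_tendsto_mul hκ hd ht (isTrajectory_trajectory _)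
  choose η hη using hlim
  have hlin : ∀ v : Fin n → ℝ, Tendsto (trajectory A κ v) atTop (𝓝 ((η ⬝ᵥ v) • σ)) := by
    intro v
    refine tendsto_pi_nhds.2 fun i => ?_
    have := tendsto_finsetSum Finset.univ fun r _ =>
      ((tendsto_pi_nhds.1 (hη r) i).const_mul (v r))
    simp only [← trajectory_eq_sum_single] at this
    convert this using 2
    simp only [Pi.smul_apply, smul_eq_mul, dotProduct, Finset.sum_mul]
    exact Finset.sum_congr rfl fun r _ => by ring
  have hσ0 : σ 0 ≠ 0 := by
    intro h0
    simpa [h0] using mul_self_of_sign (h.1 0)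
  have hcoef : ∀ {a b : ℝ}, a • σ = b • σ → a = b := fun {a b} hab =>
    mul_right_cancel₀ hσ0 (congrFun hab 0)
  have hone : η ⬝ᵥ σ = 1 := by
    refine hcoef (tendsto_nhds_unique (hlin σ) ?_)
    rw [one_smul]
    exact tendsto_const_nhds.congr fun k => (h.trajectory_eq k).symm
  have hnn : ∀ r, 0 ≤ σ r * η r := by
    intro r
    -- In switched coordinates the start is `σ r` times a basis vector, and the evolution has
    -- nonnegative coefficients.
    have hk : ∀ k i, 0 ≤ σ r * (σ i * trajectory A κ (Pi.single r 1) k i) := by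
      intro k
      induction k with
      | zero =>
        intro i
        rw [trajectory_zero]
        by_cases hir : i = r
        · subst hir
          rw [Pi.single_eq_same, mul_one, mul_self_of_sign (h.1 i)]
          exact zero_le_one
        · rw [Pi.single_eq_of_ne hir, mul_zero, mul_zero]
      | succ k ih =>
        intro i
        rw [(isTrajectory_trajectory _).succ_apply]
        have h1 : 0 ≤ (1 - κ * modDegree A i) *
            (σ r * (σ i * trajectory A κ (Pi.single r 1) k i)) :=
          mul_nonneg (by linarith [hd i]) (ih i)
        have h2 : 0 ≤ κ * ∑ j, |A i j| * (σ r * (σ j * trajectory A κ (Pi.single r 1) k j)) :=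
          mul_nonneg hκ.le (Finset.sum_nonneg fun j _ => mul_nonneg (abs_nonneg _) (ih j))
        refine (add_nonneg h1 h2).trans_eq (Eq.symm ?_)
        simp only [← h.mul_mul_eq_abs, mul_add, Finset.mul_sum]
        congr 1
        · ring
        · refine Finset.sum_congr rfl fun j _ => ?_
          linear_combination (-(κ * σ i * A i j * σ r * trajectory A κ (Pi.single r 1) k j)) *
            mul_self_of_sign (h.1 j)
    have hl := ((tendsto_pi_nhds.1 (hη r) r).const_mul (σ r)).const_mul (σ r)
    have := ge_of_tendsto' hl (fun k => hk k r)
    have h2 : σ r * (σ r * (η r • σ) r) = σ r * η r := by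
      simp only [Pi.smul_apply, smul_eq_mul]
      linear_combination σ r * η r * mul_self_of_sign (h.1 r)
    rwa [h2] at this
  refine ⟨η, ⟨fun i => σ i * η i, hnn, ?_⟩, ?_, ?_⟩
  · ext i
    rw [mulVec_diagonal]
    linear_combination (-η i) * mul_self_of_sign (h.1 i)
  · have hinv : ∀ v, (η ᵥ* laplacian A) ⬝ᵥ v = 0 := by
      intro v
      have h1 := (tendsto_add_atTop_iff_nat 1).2 (hlin v)
      have h2 : (fun k => trajectory A κ v (k + 1)) =
          trajectory A κ (v - κ • laplacian A *ᵥ v) := by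
        ext k : 1
        simp only [trajectory]
        rw [pow_succ, ← mulVec_mulVec, sub_mulVec, one_mulVec, smul_mulVec]
      rw [h2] at h1
      have h3 := hcoef (tendsto_nhds_unique h1 (hlin _))
      rw [dotProduct_sub, dotProduct_smul, dotProduct_mulVec, smul_eq_mul] at h3
      have h4 : κ * ((η ᵥ* laplacian A) ⬝ᵥ v) = 0 := by linarith
      exact (mul_eq_zero.1 h4).resolve_left hκ.ne'
    exact dotProduct_eq_zero _ hinv
  · rw [← hone]
    refine Finset.sum_congr rfl fun i _ => ?_
    rw [mul_comm (η i), ← abs_of_nonneg (hnn i), abs_mul, abs_of_sign (h.1 i), one_mul]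

/-! ### From complex phases to signs -/

theorem essentiallyNonneg_iff : EssentiallyNonneg (A.map Complex.ofReal) ↔
    ∃ ζ : Fin n → ℂ, (∀ i, ‖ζ i‖ = 1) ∧
      ∃ B : Fin n → Fin n → ℝ, (∀ i j, 0 ≤ B i j) ∧
        ∀ i j, (A i j : ℂ) * ζ j = B i j * ζ i := by
  have key : ∀ ζ : Fin n → ℂ, (∀ i, ‖ζ i‖ = 1) → ∀ B : Matrix (Fin n) (Fin n) ℝ,
      B.map Complex.ofReal = (diagonal ζ)⁻¹ * A.map Complex.ofReal * diagonal ζ ↔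
        ∀ i j, (A i j : ℂ) * ζ j = B i j * ζ i := by
    intro ζ hζ B
    have hne : ∀ i, ζ i ≠ 0 := fun i h0 => by simpa [h0] using hζ i
    have hinv : (diagonal ζ)⁻¹ = diagonal fun i => (ζ i)⁻¹ := by
      refine inv_eq_right_inv ?_
      rw [diagonal_mul_diagonal, ← diagonal_one]
      exact congrArg _ (funext fun i => mul_inv_cancel₀ (hne i))
    rw [hinv, ← Matrix.ext_iff]
    refine forall_congr' fun i => forall_congr' fun j => ?_
    rw [diagonal_mul_mul_diagonal_apply, map_apply, map_apply]
    have := hne i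
    constructor
    · intro hB
      rw [hB]
      field_simp
    · intro hB
      field_simp
      linear_combination -hB
  constructor
  · rintro ⟨B, hB, ζ, hζ, h⟩
    exact ⟨ζ, hζ, B, hB, (key ζ hζ B).1 h⟩
  · rintro ⟨ζ, hζ, B, hB, h⟩
    exact ⟨B, hB, ζ, hζ, (key ζ hζ B).2 h⟩

theorem IsSignSwitching.essentiallyNonneg (h : IsSignSwitching A σ) :
    EssentiallyNonneg (A.map Complex.ofReal) := by
  refine essentiallyNonneg_iff.2 ⟨fun i => (σ i : ℂ), fun i => ?_, fun i j => |A i j|,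
    fun i j => abs_nonneg _, fun i j => ?_⟩
  · rw [Complex.norm_real, Real.norm_eq_abs, abs_of_sign (h.1 i)]
  · beta_reduce
    rw [← h.mul_mul_eq_abs]
    norm_cast
    linear_combination (-(A i j * σ j)) * mul_self_of_sign (h.1 i)

/-- If the digraph has a root, the phases in an essentially nonnegative real matrix can be taken to
be signs, those relative to the phase of the root. -/
theorem exists_isSignSwitching (he : EssentiallyNonneg (A.map Complex.ofReal))
    (ht : HasSpanningTree (assocDigraph A)) : ∃ σ, IsSignSwitching A σ := by
  obtain ⟨ζ, hζ, B, hB, h⟩ := essentiallyNonneg_iff.1 he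
  obtain ⟨r, hr⟩ := ht
  have hne : ∀ i, ζ i ≠ 0 := fun i h0 => by simpa [h0] using hζ i
  have habs : ∀ i j, |A i j| = B i j := by
    intro i j
    have := congrArg norm (h i j)
    simpa [hζ, abs_of_nonneg (hB i j)] using this
  have hsign : ∀ i, ∃ s : ℝ, (s = 1 ∨ s = -1) ∧ ζ i = s * ζ r := by
    intro i
    induction hr i with
    | refl => exact ⟨1, Or.inl rfl, by simp⟩
    | @tail j i _ hji ih =>
      obtain ⟨s, hs, hj⟩ := ih
      have hA0 : A i j ≠ 0 := hji
      have hA0c : (A i j : ℂ) ≠ 0 := by exact_mod_cast hA0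
      have hij := h i j
      rw [← habs] at hij
      -- A positive entry keeps the phase across the edge, a negative one reverses it.
      rcases abs_choice (A i j) with ha | ha <;> rw [ha] at hij
      · exact ⟨s, hs, by rw [← hj]; exact (mul_left_cancel₀ hA0c hij).symm⟩
      · refine ⟨-s, hs.symm.imp (fun h => by rw [h, neg_neg]) (fun h => by rw [h]), ?_⟩
        refine mul_left_cancel₀ hA0c ?_
        push_cast at hij ⊢
        linear_combination hij - (A i j : ℂ) * hj
  choose σ hσ hζσ using hsign
  refine ⟨σ, isSignSwitching_iff.2 ⟨hσ, fun i j => ?_⟩⟩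
  have hij := h i j
  rw [hζσ i, hζσ j, ← mul_assoc, ← mul_assoc] at hij
  have hij' : A i j * σ j = B i j * σ i := by exact_mod_cast mul_right_cancel₀ (hne r) hij
  have : σ i * A i j * σ j = B i j := by
    linear_combination σ i * hij' + B i j * mul_self_of_sign (hσ i)
  rw [this]
  exact hB i j

/-! ### The equivalence with bipartite consensus -/

/-- The limit of a convergent trajectory is an equilibrium. -/
theorem IsTrajectory.laplacian_mulVec_eq_zero (hκ : 0 < κ) {x : ℕ → Fin n → ℝ}
    (hx : IsTrajectory A κ x) {c : Fin n → ℝ} (hc : Tendsto x atTop (𝓝 c)) :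
    laplacian A *ᵥ c = 0 := by
  have hcont : Continuous fun v : Fin n → ℝ => v - κ • laplacian A *ᵥ v := by fun_prop
  have h1 : Tendsto (fun k => x (k + 1)) atTop (𝓝 (c - κ • laplacian A *ᵥ c)) :=
    ((hcont.tendsto c).comp hc).congr fun k => (hx k).symm
  have h2 := tendsto_nhds_unique h1 ((tendsto_add_atTop_iff_nat 1).2 hc)
  exact (smul_eq_zero.1 (sub_eq_self.1 h2)).resolve_left hκ.ne'

/-- A null vector of the Laplacian whose entries are signs switches the matrix to a nonnegative
one. -/
theorem isSignSwitching_of_laplacian_mulVec (hσ : ∀ i, σ i = 1 ∨ σ i = -1)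
    (h : laplacian A *ᵥ σ = 0) : IsSignSwitching A σ := by
  refine isSignSwitching_iff.2 ⟨hσ, fun i j => ?_⟩
  -- Nonnegative terms whose sum is `σ_i (Lσ)_i = 0` all vanish.
  have hle : ∀ j, 0 ≤ |A i j| - σ i * A i j * σ j := by
    intro j
    have := le_abs_self (σ i * A i j * σ j)
    rw [abs_mul, abs_mul, abs_of_sign (hσ i), abs_of_sign (hσ j)] at this
    linarith
  have hsum : ∑ j, (|A i j| - σ i * A i j * σ j) = 0 := by
    have h1 := congrFun h i
    simp only [laplacian, sub_mulVec, Pi.sub_apply, mulVec_diagonal, Pi.zero_apply] at h1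
    simp only [mulVec, dotProduct] at h1
    rw [Finset.sum_sub_distrib]
    simp only [mul_assoc, ← Finset.mul_sum]
    change modDegree A i - _ = 0
    linear_combination σ i * h1 - modDegree A i * mul_self_of_sign (hσ i)
  have := (Finset.sum_eq_zero_iff_of_nonneg fun j _ => hle j).1 hsum j (Finset.mem_univ j)
  linarith [abs_nonneg (A i j)]

theorem AchievesBipartiteConsensus.exists_isSignSwitching (hκ : 0 < κ)
    (h : AchievesBipartiteConsensus A κ) : ∃ σ, IsSignSwitching A σ := by
  obtain ⟨hall, x, hx, a, ha, hxa⟩ := h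
  obtain ⟨c, hc, -⟩ := hall x hx
  have hca : ∀ i, |c i| = a := fun i => tendsto_nhds_unique (hc i).abs (hxa i)
  have hker := hx.laplacian_mulVec_eq_zero hκ (tendsto_pi_nhds.2 hc)
  refine ⟨a⁻¹ • c, isSignSwitching_of_laplacian_mulVec (fun i => ?_) ?_⟩
  · rw [Pi.smul_apply, smul_eq_mul]
    rcases eq_or_eq_neg_of_abs_eq (hca i) with h | h <;> rw [h]
    · exact Or.inl (inv_mul_cancel₀ ha.ne')
    · exact Or.inr (by rw [mul_neg, inv_mul_cancel₀ ha.ne'])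
  · rw [mulVec_smul, hker, smul_zero]

/-- Some basis vector has a nonvanishing limit; its index is a root. -/
theorem AchievesBipartiteConsensus.hasSpanningTree [NeZero n]
    (h : AchievesBipartiteConsensus A κ) : HasSpanningTree (assocDigraph A) := by
  obtain ⟨hall, x, hx, a, ha, hxa⟩ := h
  choose c hc hcabs using fun r : Fin n =>
    hall _ (isTrajectory_trajectory (A := A) (κ := κ) (Pi.single r 1))
  have hxlim : Tendsto (fun k => x k 0) atTop (𝓝 (∑ r, x 0 r * c r 0)) := by
    refine (tendsto_finsetSum Finset.univ fun r _ => (hc r 0).const_mul (x 0 r)).congr fun k => ?_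
    rw [← trajectory_eq_sum_single, ← hx.eq_trajectory]
  have hne : ∑ r, x 0 r * c r 0 ≠ 0 := by
    rw [← abs_pos, tendsto_nhds_unique hxlim.abs (hxa 0)]
    exact ha
  obtain ⟨r, -, hr⟩ := Finset.exists_ne_zero_of_sum_ne_zero hne
  refine ⟨r, fun i => ?_⟩
  -- The limits from `e_r` share one modulus, so nonvanishing at vertex `0` carries over to all
  -- vertices.
  have hri : c r i ≠ 0 := by
    rw [← abs_pos, hcabs r i 0, abs_pos]
    exact right_ne_zero_of_mul hr
  obtain ⟨k, hk⟩ := ((hc r i).eventually_ne hri).exists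
  exact reflTransGen_of_trajectory_single_ne_zero k i hk

/-- The equilibrium `σ` itself supplies the trajectory that does not die out. -/
theorem IsSignSwitching.achievesBipartiteConsensus (h : IsSignSwitching A σ) (hκ : 0 < κ)
    (hd : ∀ i, κ * modDegree A i < 1) (ht : HasSpanningTree (assocDigraph A)) :
    AchievesBipartiteConsensus A κ := by
  refine ⟨fun x hx => ?_, trajectory A κ σ, isTrajectory_trajectory σ, 1, one_pos, fun i => ?_⟩
  · obtain ⟨c, hc⟩ := h.exists_tendsto_mul hκ hd ht hx
    refine ⟨c • σ, tendsto_pi_nhds.1 hc, fun i j => ?_⟩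
    simp only [Pi.smul_apply, smul_eq_mul, abs_mul, abs_of_sign (h.1 _)]
  · simp only [h.trajectory_eq, abs_of_sign (h.1 i)]
    exact tendsto_const_nhds

end SignedConsensus

theorem mainTheorem8 {n : ℕ} [NeZero n] (A : Matrix (Fin n) (Fin n) ℝ)
    (hA : ∀ i, A i i = 0) (κ : ℝ) (hκ : 0 < κ)
    -- `κ < 1 / Δ`, where `1 / Δ` is read as `∞` if `Δ = 0`
    (hκΔ : κ * SignedConsensus.maxDegree A < 1) :
    (SignedConsensus.AchievesBipartiteConsensus A κ ↔
      SignedConsensus.EssentiallyNonneg (A.map Complex.ofReal) ∧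
        SignedConsensus.HasSpanningTree (SignedConsensus.assocDigraph A)) ∧
    (SignedConsensus.EssentiallyNonneg (A.map Complex.ofReal) ∧
        SignedConsensus.HasSpanningTree (SignedConsensus.assocDigraph A) →
      (∃ σ, SignedConsensus.IsSignSwitching A σ) ∧
      ∀ σ, SignedConsensus.IsSignSwitching A σ →
        (∃ η, SignedConsensus.IsNormalizedLeftNull A σ η) ∧
        ∀ η, SignedConsensus.IsNormalizedLeftNull A σ η →
          ∀ x, SignedConsensus.IsTrajectory A κ x →
            Tendsto x atTop (𝓝 ((η ⬝ᵥ x 0) • σ))) := by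
  have hd := SignedConsensus.mul_modDegree_lt_one hκ hκΔ
  refine ⟨⟨fun h => ?_, fun ⟨he, ht⟩ => ?_⟩, fun ⟨he, ht⟩ => ?_⟩
  · obtain ⟨σ, hσ⟩ := h.exists_isSignSwitching hκ
    exact ⟨hσ.essentiallyNonneg, h.hasSpanningTree⟩
  · obtain ⟨σ, hσ⟩ := SignedConsensus.exists_isSignSwitching he ht
    exact hσ.achievesBipartiteConsensus hκ hd ht
  · exact ⟨SignedConsensus.exists_isSignSwitching he ht, fun σ hσ =>
      ⟨hσ.exists_isNormalizedLeftNull hκ hd ht, fun η hη x hx =>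
        hσ.tendsto_of_isNormalizedLeftNull hκ hd ht hη hx⟩⟩
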